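/- Let $d_1,\dots,d_n\ge 1$ be integers and $\mathcal H=\mathbb C^{d_1}\otimes\cdots\otimes\mathbb C^{d_n}$. An $n$-partite pure state is a unit vector $|\psi\rangle\in\mathcal H$; it is product across the cut $S:S^c$, where $\emptyset\ne S\subsetneq\{1,\dots,n\}$, if $|\psi\rangle=|\alpha\rangle_S\otimes|\beta\rangle_{S^c}$ for some unit vectors $|\alpha\rangle$, $|\beta\rangle$ in the tensor products of the factors indexed by $S$ and by $S^c$. Let $\mathcal P\subset\mathcal H$ be the set of pure states that are product across some such cut. For pure states let $\|\psi-\phi\|_{\mathrm{tr}}=\tfrac12\operatorname{tr}\bigl|\,|\psi\rangle\langle\psi|-|\phi\rangle\langle\phi|\,\bigr|$ be the trace distance. A quantum $\varepsilon$-tester for $\mathcal P$ using $k$ copies is a two-outcome measurement $\{\Lambda,I-\Lambda\}$, $0\le\Lambda\le I$, on $\mathcal H^{\otimes k}$ such that, for every pure state $|\psi\rangle\in\mathcal H$: if $|\psi\rangle\in\mathcal P$, then $|\psi\rangle^{\otimes k}$ is accepted (outcome $\Lambda$) with probability at least $2/3$; and if $\inf_{|\phi\rangle\in\mathcal P}\|\psi-\phi\|_{\mathrm{tr}}\ge\varepsilon$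 (with $\inf\emptyset=+\infty$), then $|\psi\rangle^{\otimes k}$ is rejected with probability at least $2/3$. Theorem. There is a universal constant $C>0$ such that for every $n$ and every $\varepsilon>0$ there is an integer $0\le k\le C\,n/\varepsilon^2$ with the following property: for all local dimensions $d_1,\dots,d_n$ there is a quantum $\varepsilon$-tester, using $k$ copies of the state, for the property $\mathcal P$ of being product across some cut. -/

import Mathlib

open scoped BigOperators

noncomputable section

namespace QTest

variable {ι : Type} [Fintype ι] [DecidableEq ι]

/-- The rank-one operator `|ψ⟩⟨ψ|`. -/
def proj (ψ : EuclideanSpace ℂ ι) : Matrix ι ι ℂ :=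
  Matrix.vecMulVec (fun x => ψ x) (fun x => star (ψ x))

open scoped MatrixOrder in
/-- The trace norm `tr |A|`, where `|A| = √(A* A)`. -/
def trAbs (A : Matrix ι ι ℂ) : ℝ := (CFC.abs A).trace.re

/-- The trace distance `(1/2) tr | |ψ⟩⟨ψ| - |φ⟩⟨φ| |` of two pure states. -/
def traceDist (ψ φ : EuclideanSpace ℂ ι) : ℝ := (1 / 2) * trAbs (proj ψ - proj φ)

/-- The state `ψ^{⊗k}`, as a vector of `(ℂ^ι)^{⊗k} = ℂ^(ι^k)`. -/
def tensorPow (k : ℕ) (ψ : EuclideanSpace ℂ ι) : EuclideanSpace ℂ (Fin k → ι) :=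
  WithLp.toLp 2 fun x => ∏ j, ψ (x j)

open scoped ComplexOrder in
/-- `Λ` is the accepting element of a two-outcome measurement `{Λ, I - Λ}`: `0 ≤ Λ ≤ I`. -/
def IsMeasurement (Λ : Matrix ι ι ℂ) : Prop := Λ.PosSemidef ∧ (1 - Λ).PosSemidef

/-- The probability `tr (Λ |ψ⟩⟨ψ|)` that the measurement `{Λ, I - Λ}` accepts `ψ`. -/
def acceptProb (Λ : Matrix ι ι ℂ) (ψ : EuclideanSpace ℂ ι) : ℝ := (Λ * proj ψ).trace.re

/-- `Λ` is a quantum `ε`-tester for the set `P` of pure states, using `k` copies of the input: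
a two-outcome measurement on `k` copies that accepts every state in `P` with probability at
least `2/3` and rejects with probability at least `2/3` every state at trace distance at least
`ε` from `P` (the infimum over the empty set being `+∞`). -/
def IsTester (P : Set (EuclideanSpace ℂ ι)) (ε : ℝ) (k : ℕ)
    (Λ : Matrix (Fin k → ι) (Fin k → ι) ℂ) : Prop :=
  IsMeasurement Λ ∧
    ∀ ψ : EuclideanSpace ℂ ι, ‖ψ‖ = 1 →
      (ψ ∈ P → 2 / 3 ≤ acceptProb Λ (tensorPow k ψ)) ∧
      ((ε : EReal) ≤ ⨅ φ ∈ P, (traceDist ψ φ : EReal) →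
        2 / 3 ≤ 1 - acceptProb Λ (tensorPow k ψ))

/-- The space `ℂ^{d 0} ⊗ ⋯ ⊗ ℂ^{d (n-1)}` of `n` qudits, in the computational basis. -/
abbrev Qudits {n : ℕ} (d : Fin n → ℕ) : Type := EuclideanSpace ℂ ((i : Fin n) → Fin (d i))

/-- `ψ = |α⟩_S ⊗ |β⟩_{Sᶜ}` for some states `α` of the subsystems in `S` and `β` of the others. -/
def IsProductAcross {n : ℕ} {d : Fin n → ℕ} (S : Finset (Fin n)) (ψ : Qudits d) : Prop :=
  ∃ (α : EuclideanSpace ℂ ((i : {i // i ∈ S}) → Fin (d i)))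
    (β : EuclideanSpace ℂ ((i : {i // i ∉ S}) → Fin (d i))),
    ‖α‖ = 1 ∧ ‖β‖ = 1 ∧
      ∀ x : (i : Fin n) → Fin (d i), ψ x = α (fun i => x i) * β (fun i => x i)

/-- The pure states of `n` qudits that are product across some cut `S : Sᶜ`, where `S` is a
nonempty proper subset of the parties. -/
def productAcrossSomeCut {n : ℕ} (d : Fin n → ℕ) : Set (Qudits d) :=
  {ψ | ‖ψ‖ = 1 ∧ ∃ S : Finset (Fin n), S.Nonempty ∧ S ≠ Finset.univ ∧ IsProductAcross S ψ}

end QTest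

end

noncomputable section

namespace QTest

open Matrix
open scoped ComplexOrder

/-! ### Projections, the quantum OR, and the trace distance of pure states. -/

section General

variable {ι : Type} [Fintype ι]

/-! For a fixed cut, the swap test on one side of two copies accepts with probability (1 +
purity)/2, where the purity is that of the reduced state. It accepts product states with certainty.
If every product state across the cut has squared overlap at most 1 - ε² with `ψ`, the purity is at
most 1 - ε² (`purity_le`), so `m` independent tests all accept with probability at most (1 -
ε²/2)^m.

Fewer than 2^n cuts have to be tested on the same copies. `exists_or_measurement` merges the test
projections `Q s` into `Λ = A (A + 1/2)⁻¹` with `A = ∑ Q s`: a state fixed by one `Q s` keeps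
acceptance 2/3, and soundness costs only a union bound with factor 2. Hence `m` of order n/ε²
suffices, whatever the local dimensions. `traceDist_sq` turns distance into overlap. -/

lemma dotProduct_star_self_re (ψ : EuclideanSpace ℂ ι) :
    (star ψ.ofLp ⬝ᵥ ψ.ofLp).re = ‖ψ‖ ^ 2 := by
  rw [dotProduct_comm, ← EuclideanSpace.inner_eq_star_dotProduct, inner_self_eq_norm_sq_to_K]
  norm_cast

lemma dotProduct_star_self_of_norm_eq_one {ψ : EuclideanSpace ℂ ι} (h : ‖ψ‖ = 1) :
    star ψ.ofLp ⬝ᵥ ψ.ofLp = 1 := by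
  rw [dotProduct_comm, ← EuclideanSpace.inner_eq_star_dotProduct, inner_self_eq_norm_sq_to_K, h]
  simp

/-- Cauchy–Schwarz against a unit vector. -/
lemma sq_re_dotProduct_le {v : ι → ℂ} (hv : star v ⬝ᵥ v = 1) (w : ι → ℂ) :
    ((star v ⬝ᵥ w).re) ^ 2 ≤ (star w ⬝ᵥ w).re := by
  have h1 := dotProduct_star_self_re (WithLp.toLp 2 v)
  have h2 := dotProduct_star_self_re (WithLp.toLp 2 w)
  have h3 := norm_inner_le_norm (𝕜 := ℂ) (WithLp.toLp 2 v) (WithLp.toLp 2 w)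
  rw [EuclideanSpace.inner_eq_star_dotProduct, dotProduct_comm] at h3
  simp only [hv, Complex.one_re] at h1 h2 h3
  have h4 : ‖WithLp.toLp 2 v‖ = 1 := by
    have := norm_nonneg (WithLp.toLp 2 v)
    nlinarith
  rw [h4, one_mul] at h3
  rw [h2]
  have h5 := (Complex.abs_re_le_norm (star v ⬝ᵥ w)).trans h3
  exact sq_le_sq' (by linarith [neg_abs_le (star v ⬝ᵥ w).re]) ((le_abs_self _).trans h5)

lemma posSemidef_of_isHermitian_of_sq_eq {Q : Matrix ι ι ℂ} (hQ : Q.IsHermitian)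
    (h2 : Q * Q = Q) : Q.PosSemidef := by
  have := posSemidef_conjTranspose_mul_self Q
  rwa [hQ.eq, h2] at this

/-- Since `Q v = v`, the vectors `w` and `Q w` have the same overlap with `v`; Cauchy–Schwarz is
applied to `Q w`. In effect `Q` dominates `|v⟩⟨v|`. -/
lemma sq_re_dotProduct_le_of_fixed {Q : Matrix ι ι ℂ} (hQ : Q.IsHermitian) (h2 : Q * Q = Q)
    {v : ι → ℂ} (hv : star v ⬝ᵥ v = 1) (hfix : Q *ᵥ v = v) (w : ι → ℂ) :
    ((star v ⬝ᵥ w).re) ^ 2 ≤ (star w ⬝ᵥ Q *ᵥ w).re := by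
  have h := sq_re_dotProduct_le hv (Q *ᵥ w)
  have e1 : star v ⬝ᵥ Q *ᵥ w = star v ⬝ᵥ w := by
    rw [dotProduct_mulVec]
    congr 1
    rw [← hQ.eq, ← star_mulVec, hfix]
  have e2 : star (Q *ᵥ w) ⬝ᵥ Q *ᵥ w = star w ⬝ᵥ Q *ᵥ w := by
    rw [star_mulVec, hQ.eq, ← dotProduct_mulVec, mulVec_mulVec, h2]
  rwa [e1, e2] at h

lemma acceptProb_eq (Λ : Matrix ι ι ℂ) (ψ : EuclideanSpace ℂ ι) :
    acceptProb Λ ψ = (star ψ.ofLp ⬝ᵥ Λ *ᵥ ψ.ofLp).re := by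
  unfold acceptProb proj
  rw [mul_vecMulVec, trace_vecMulVec, dotProduct_comm]
  rfl

lemma isHermitian_proj (ψ : EuclideanSpace ℂ ι) : (proj ψ).IsHermitian :=
  (posSemidef_vecMulVec_self_star ψ.ofLp).1

lemma proj_mul_proj_mul_proj (ψ φ : EuclideanSpace ℂ ι) :
    proj ψ * proj φ * proj ψ =
      ((‖star φ.ofLp ⬝ᵥ ψ.ofLp‖ ^ 2 : ℝ) : ℂ) • proj ψ := by
  change vecMulVec ψ.ofLp (star ψ.ofLp) * vecMulVec φ.ofLp (star φ.ofLp) *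
    vecMulVec ψ.ofLp (star ψ.ofLp) = _ • vecMulVec ψ.ofLp (star ψ.ofLp)
  rw [vecMulVec_mul_vecMulVec, vecMulVec_mul_vecMulVec,
    star_dotProduct ψ.ofLp]
  ext i j
  simp [vecMulVec_apply, ← Complex.conj_mul']
  ring

lemma proj_mul_self {ψ : EuclideanSpace ℂ ι} (h : ‖ψ‖ = 1) : proj ψ * proj ψ = proj ψ := by
  change vecMulVec ψ.ofLp (star ψ.ofLp) * vecMulVec ψ.ofLp (star ψ.ofLp) =
    vecMulVec ψ.ofLp (star ψ.ofLp)
  rw [vecMulVec_mul_vecMulVec, dotProduct_star_self_of_norm_eq_one h]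
  simp

variable [DecidableEq ι]

/-- Quantum OR with perfect completeness: from projections `Q s` one obtains a single measurement
accepting any state fixed by some `Q s` with probability at least `2/3`, and accepting any state
with probability at most twice the sum of the acceptance probabilities of the `Q s`. -/
theorem exists_or_measurement {σ : Type*} (I : Finset σ) (Q : σ → Matrix ι ι ℂ)
    (hQ : ∀ s, (Q s).IsHermitian) (h2 : ∀ s, Q s * Q s = Q s) :
    ∃ Λ : Matrix ι ι ℂ, IsMeasurement Λ ∧ ∀ ψ : EuclideanSpace ℂ ι, ‖ψ‖ = 1 →
      ((∃ s ∈ I, Q s *ᵥ ψ.ofLp = ψ.ofLp) → 2 / 3 ≤ acceptProb Λ ψ) ∧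
      acceptProb Λ ψ ≤ 2 * ∑ s ∈ I, acceptProb (Q s) ψ := by
  set A : Matrix ι ι ℂ := ∑ s ∈ I, Q s with hA
  have hQp : ∀ s, (Q s).PosSemidef := fun s => posSemidef_of_isHermitian_of_sq_eq (hQ s) (h2 s)
  have hAp : A.PosSemidef := posSemidef_sum I fun s _ => hQp s
  have hc : (0 : ℝ) < 1 / 2 := by norm_num
  -- The function x/(x + 1/2) takes the value 2/3 at x = 1 and lies below 2x for x ≥ 0; `Λ = A * G⁻¹
  -- = 1 - B/2`.
  set G : Matrix ι ι ℂ := A + (1 / 2 : ℝ) • 1 with hG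
  have hGp : G.PosDef := PosDef.posSemidef_add hAp (PosDef.one.smul hc)
  set B : Matrix ι ι ℂ := G⁻¹ with hB
  have hBp : B.PosSemidef := hGp.inv.posSemidef
  have hdet : IsUnit G.det := (Matrix.isUnit_iff_isUnit_det G).1 hGp.isUnit
  have hGB : G * B = 1 := mul_nonsing_inv G hdet
  have hBG : B * G = 1 := nonsing_inv_mul G hdet
  have hAG : A = G - (1 / 2 : ℝ) • 1 := by simp [hG]
  have hAB : A * B = 1 - (1 / 2 : ℝ) • B := by
    rw [hAG, sub_mul, hGB, smul_mul_assoc, one_mul]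
  have hBA : B * A = 1 - (1 / 2 : ℝ) • B := by
    rw [hAG, mul_sub, hBG, mul_smul_comm, mul_one]
  have hΛ : (1 - (1 / 2 : ℝ) • B).PosSemidef := by
    have e : 1 - (1 / 2 : ℝ) • B = (A * B)ᴴ * (A * B) + (1 / 2 : ℝ) • (Bᴴ * A * B) := by
      rw [conjTranspose_mul, hAp.1.eq, hBp.1.eq, hBA, hAB]
      simp only [mul_sub, sub_mul, mul_one, one_mul, smul_sub, mul_smul_comm, smul_mul_assoc]
      abel
    rw [e]
    exact (posSemidef_conjTranspose_mul_self _).add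
      ((hAp.conjTranspose_mul_mul_same B).smul hc.le)
  have hΛA : ((2 : ℝ) • A - (1 - (1 / 2 : ℝ) • B)).PosSemidef := by
    have e : (2 : ℝ) • A - (1 - (1 / 2 : ℝ) • B) = (2 : ℝ) • (Aᴴ * B * A) := by
      rw [hAp.1.eq, mul_assoc, hBA, mul_sub, mul_one, mul_smul_comm, hAB]
      simp only [smul_sub, smul_smul]
      norm_num
    rw [e]
    exact (hBp.conjTranspose_mul_mul_same A).smul (by norm_num)
  refine ⟨1 - (1 / 2 : ℝ) • B, ⟨hΛ, ?_⟩, fun ψ hψ => ⟨?_, ?_⟩⟩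
  · rw [sub_sub_cancel]
    exact hBp.smul hc.le
  · rintro ⟨s, hs, hfix⟩
    have hv := dotProduct_star_self_of_norm_eq_one hψ
    set v := ψ.ofLp
    set w := B *ᵥ v with hw
    have hGw : G *ᵥ w = v := by rw [hw, mulVec_mulVec, hGB, one_mulVec]
    have h1 := sq_re_dotProduct_le_of_fixed (hQ s) (h2 s) hv hfix w
    have h3 := sq_re_dotProduct_le hv w
    have h4 : (star w ⬝ᵥ Q s *ᵥ w).re ≤ (star w ⬝ᵥ A *ᵥ w).re := by
      rw [hA, sum_mulVec, dotProduct_sum, Complex.re_sum]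
      exact Finset.single_le_sum (f := fun s => (star w ⬝ᵥ Q s *ᵥ w).re)
        (fun i _ => (Complex.le_def.1 ((hQp i).dotProduct_mulVec_nonneg w)).1) hs
    have h5 : (star w ⬝ᵥ v).re = (star w ⬝ᵥ A *ᵥ w).re + 1 / 2 * (star w ⬝ᵥ w).re := by
      rw [← hGw, hG, add_mulVec, smul_mulVec, one_mulVec, dotProduct_add, dotProduct_smul,
        Complex.add_re, Complex.smul_re, smul_eq_mul]
    have h6 : (star w ⬝ᵥ v).re = (star v ⬝ᵥ w).re := by
      rw [star_dotProduct]
      simp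
    have h7 : acceptProb (1 - (1 / 2 : ℝ) • B) ψ = 1 - 1 / 2 * (star v ⬝ᵥ w).re := by
      rw [acceptProb_eq, sub_mulVec, smul_mulVec, one_mulVec, dotProduct_sub, dotProduct_smul,
        hv, Complex.sub_re, Complex.smul_re, smul_eq_mul, Complex.one_re]
    rw [h7]
    -- With x = Re⟨v, w⟩, `h1`, `h3`, `h4` and `h5` give x ≥ x² + x²/2, so x ≤ 2/3 and 1 - x/2 ≥
    -- 2/3.
    nlinarith
  · have h := (Complex.le_def.1 (hΛA.dotProduct_mulVec_nonneg ψ.ofLp)).1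
    simp only [acceptProb_eq]
    rw [sub_mulVec, dotProduct_sub, smul_mulVec, dotProduct_smul, Complex.sub_re,
      Complex.smul_re, hA, sum_mulVec, dotProduct_sum, Complex.re_sum, smul_eq_mul,
      Complex.zero_re] at h
    linarith

open scoped MatrixOrder in
/-- The trace distance of two pure states is determined by their overlap. -/
theorem traceDist_sq {ψ φ : EuclideanSpace ℂ ι} (hψ : ‖ψ‖ = 1) (hφ : ‖φ‖ = 1) :
    traceDist ψ φ ^ 2 = 1 - ‖star φ.ofLp ⬝ᵥ ψ.ofLp‖ ^ 2 := by
  set t : ℝ := ‖star φ.ofLp ⬝ᵥ ψ.ofLp‖ ^ 2 with ht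
  have hsymm : ‖star ψ.ofLp ⬝ᵥ φ.ofLp‖ ^ 2 = t := by
    rw [star_dotProduct, norm_star]
  set P := proj ψ with hP
  set R := proj φ with hR
  have hPP : P * P = P := proj_mul_self hψ
  have hRR : R * R = R := proj_mul_self hφ
  have hPRP : P * R * P = (t : ℂ) • P := proj_mul_proj_mul_proj ψ φ
  have hRPR : R * P * R = (t : ℂ) • R := by
    rw [← hsymm]; exact proj_mul_proj_mul_proj φ ψ
  have htrP : P.trace = 1 := by
    rw [hP, proj, trace_vecMulVec, dotProduct_comm]
    exact dotProduct_star_self_of_norm_eq_one hψ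
  have htrR : R.trace = 1 := by
    rw [hR, proj, trace_vecMulVec, dotProduct_comm]
    exact dotProduct_star_self_of_norm_eq_one hφ
  have htrPR : (P * R).trace = t := by
    have : (P * R * P).trace = (P * R).trace := by
      rw [trace_mul_comm, ← mul_assoc, hPP]
    rw [← this, hPRP, trace_smul, htrP, smul_eq_mul, mul_one]
  set D := P - R with hD
  have hDh : Dᴴ = D := ((isHermitian_proj ψ).sub (isHermitian_proj φ)).eq
  have hD2 : D * D = P + R - P * R - R * P := by
    rw [hD, mul_sub, sub_mul, sub_mul, hPP, hRR]; abel
  have htrD : (D * D).trace = ((2 * (1 - t) : ℝ) : ℂ) := by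
    rw [hD2, trace_sub, trace_sub, trace_add, htrP, htrR, trace_mul_comm R P, htrPR]
    push_cast; ring
  -- The nonzero eigenvalues of `D` can only be ±√(1 - t), so |D| = D²/√(1 - t) when t < 1; t = 1
  -- forces `D = 0`.
  have hD3 : D * D * D = ((1 - t : ℝ) : ℂ) • D := by
    have : D * D * D = P - R - P * R * P + R * P * R := by
      rw [hD2, hD]
      simp only [mul_sub, sub_mul, add_mul, hPP, hRR, mul_assoc P R R, mul_assoc R P P]
      abel
    rw [this, hPRP, hRPR, hD]
    push_cast
    module
  have hpos : (D * D).PosSemidef := by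
    have := posSemidef_conjTranspose_mul_self D
    rwa [hDh] at this
  have ht1 : 0 ≤ 1 - t := by
    have h := (Complex.le_def.1 hpos.trace_nonneg).1
    rw [htrD, Complex.zero_re, Complex.ofReal_re] at h
    linarith
  rcases ht1.eq_or_lt with h0 | h0
  · have : D = 0 := by
      rw [← trace_conjTranspose_mul_self_eq_zero_iff, hDh, htrD, ← h0]
      simp
    rw [traceDist, ← hP, ← hR, ← hD, this, trAbs, CFC.abs_zero]
    simp [← h0]
  · set s := Real.sqrt (1 - t) with hs
    have hs0 : 0 < s := Real.sqrt_pos.2 h0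
    have hss : s * s = 1 - t := Real.mul_self_sqrt ht1
    have habs : CFC.abs D = s⁻¹ • (D * D) := by
      apply CFC.sqrt_unique
      · rw [star_eq_conjTranspose, hDh, smul_mul_smul_comm, ← mul_assoc, hD3, smul_mul_assoc,
          ← hss, ← mul_inv]
        ext i j
        simp only [Matrix.smul_apply, Complex.real_smul, smul_eq_mul]
        push_cast
        have : (s : ℂ) ≠ 0 := by exact_mod_cast hs0.ne'
        field_simp
      · exact (hpos.smul (inv_nonneg.2 hs0.le)).nonneg
    rw [traceDist, ← hP, ← hR, ← hD, trAbs, habs, trace_smul, htrD, Complex.smul_re,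
      Complex.ofReal_re, ← hss, smul_eq_mul]
    field_simp

end General

/-! ### Tensor powers and the grouping of copies into pairs. -/

section TensorPower

variable {κ : Type}

/-- The `m`-th tensor power of a matrix. -/
def matrixTensorPow (m : ℕ) (T : Matrix κ κ ℂ) : Matrix (Fin m → κ) (Fin m → κ) ℂ :=
  Matrix.of fun x y => ∏ j, T (x j) (y j)

lemma matrixTensorPow_isHermitian (m : ℕ) {T : Matrix κ κ ℂ} (hT : T.IsHermitian) :
    (matrixTensorPow m T).IsHermitian := by
  ext x y
  simp only [conjTranspose_apply, matrixTensorPow, of_apply, star_prod]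
  exact Finset.prod_congr rfl fun j _ => hT.apply _ _

variable [Fintype κ]

lemma sum_prod_eq_prod_sum (m : ℕ) (f : Fin m → κ → ℂ) :
    ∑ z : Fin m → κ, ∏ j, f j (z j) = ∏ j, ∑ c, f j c := by
  classical
  rw [Finset.prod_univ_sum, Fintype.piFinset_univ]

lemma matrixTensorPow_mul (m : ℕ) (T U : Matrix κ κ ℂ) :
    matrixTensorPow m T * matrixTensorPow m U = matrixTensorPow m (T * U) := by
  ext x y
  simp only [mul_apply, matrixTensorPow, of_apply, ← Finset.prod_mul_distrib]
  exact sum_prod_eq_prod_sum m fun j c => T (x j) c * U c (y j)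

lemma matrixTensorPow_mulVec (m : ℕ) (T : Matrix κ κ ℂ) (u : κ → ℂ) :
    matrixTensorPow m T *ᵥ (fun x => ∏ j, u (x j)) = fun x => ∏ j, (T *ᵥ u) (x j) := by
  ext x
  simp only [mulVec, dotProduct, matrixTensorPow, of_apply, ← Finset.prod_mul_distrib]
  exact sum_prod_eq_prod_sum m fun j c => T (x j) c * u c

lemma star_prod_dotProduct_prod (m : ℕ) (u w : κ → ℂ) :
    star (fun x : Fin m → κ => ∏ j, u (x j)) ⬝ᵥ (fun x => ∏ j, w (x j)) =
      (star u ⬝ᵥ w) ^ m := by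
  simp only [dotProduct, Pi.star_apply, star_prod, ← Finset.prod_mul_distrib]
  rw [sum_prod_eq_prod_sum m fun _ c => star (u c) * w c]
  simp

/-- The vector `ψ ⊗ ψ`. -/
def pairVec {X : Type} (ψ : X → ℂ) (p : X × X) : ℂ := ψ p.1 * ψ p.2

/-- Grouping `m + m` copies into `m` pairs. -/
def pairsEquiv (X : Type) (m : ℕ) : (Fin (m + m) → X) ≃ (Fin m → X × X) :=
  (Fin.appendEquiv m m).symm.trans (Equiv.arrowProdEquivProdArrow (Fin m) _ _).symm

lemma tensorPow_eq_pairs {X : Type} (m : ℕ) (ψ : EuclideanSpace ℂ X) :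
    (tensorPow (m + m) ψ).ofLp =
      (fun y : Fin m → X × X => ∏ j, pairVec ψ.ofLp (y j)) ∘ pairsEquiv X m := by
  ext x
  simp only [tensorPow, Fin.prod_univ_add, Function.comp_apply, pairVec, Finset.prod_mul_distrib]
  rfl

lemma norm_tensorPow {X : Type} [Fintype X] (k : ℕ) {ψ : EuclideanSpace ℂ X} (h : ‖ψ‖ = 1) :
    ‖tensorPow k ψ‖ = 1 := by
  have h1 := dotProduct_star_self_re (tensorPow k ψ)
  have h2 := star_prod_dotProduct_prod k ψ.ofLp ψ.ofLp
  rw [dotProduct_star_self_of_norm_eq_one h, one_pow] at h2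
  change (star (fun x : Fin k → X => ∏ j, ψ (x j)) ⬝ᵥ (fun x => ∏ j, ψ (x j))).re = _ at h1
  rw [h2, Complex.one_re] at h1
  exact (pow_eq_one_iff_of_nonneg (norm_nonneg _) two_ne_zero).1 h1.symm

end TensorPower

/-! ### Purity of a reduced state versus overlap with product vectors. -/

section Bipartite

variable {X A B : Type} (e : X ≃ A × B) [Fintype A] [Fintype B]

/-- The purity `tr ρ²` of the reduced state of `ψ` on `A`. -/
def purity (ψ : X → ℂ) : ℝ :=
  ∑ a, ∑ a', ‖∑ b, ψ (e.symm (a, b)) * star (ψ (e.symm (a', b)))‖ ^ 2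

lemma purity_nonneg (ψ : X → ℂ) : 0 ≤ purity e ψ := by
  unfold purity; positivity

variable [Fintype X]

lemma sum_equiv_prod {M : Type*} [AddCommMonoid M] (f : X → M) :
    ∑ x, f x = ∑ a, ∑ b, f (e.symm (a, b)) := by
  rw [← Fintype.sum_prod_type', ← e.symm.sum_comp]

/-- The product vector `α ⊗ β`. -/
def tensorVec (α : EuclideanSpace ℂ A) (β : EuclideanSpace ℂ B) : EuclideanSpace ℂ X :=
  WithLp.toLp 2 fun x => α (e x).1 * β (e x).2

lemma norm_tensorVec {α : EuclideanSpace ℂ A} {β : EuclideanSpace ℂ B}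
    (hα : ‖α‖ = 1) (hβ : ‖β‖ = 1) : ‖tensorVec e α β‖ = 1 := by
  have h : ‖tensorVec e α β‖ ^ 2 = ‖α‖ ^ 2 * ‖β‖ ^ 2 := by
    simp only [EuclideanSpace.norm_sq_eq, Finset.sum_mul_sum, sum_equiv_prod e]
    simp [tensorVec, mul_pow]
  rw [hα, hβ] at h
  exact (pow_eq_one_iff_of_nonneg (norm_nonneg _) two_ne_zero).1 (by simpa using h)

/-- If all overlaps of `ψ` with product vectors are at most `l`, so is the purity. -/
lemma purity_le {ψ : EuclideanSpace ℂ X} (hψ : ‖ψ‖ = 1) {l : ℝ} (hl : 0 ≤ l)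
    (h : ∀ (α : EuclideanSpace ℂ A) (β : EuclideanSpace ℂ B), ‖α‖ = 1 → ‖β‖ = 1 →
      ‖star (tensorVec e α β).ofLp ⬝ᵥ ψ.ofLp‖ ^ 2 ≤ l) :
    purity e ψ.ofLp ≤ l := by
  -- Operator norm bound for the coefficient matrix of `ψ`: contracting with `v` gives `W`, and the
  -- normalised `W ⊗ v` is the product vector to test. The purity sums this over the rows `v` of
  -- `ψ`.
  have key : ∀ v : B → ℂ, ∑ a, ‖∑ b, ψ (e.symm (a, b)) * star (v b)‖ ^ 2 ≤
      l * ∑ b, ‖v b‖ ^ 2 := by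
    intro v
    set V : EuclideanSpace ℂ B := WithLp.toLp 2 v with hV
    set W : EuclideanSpace ℂ A :=
      WithLp.toLp 2 fun a => ∑ b, ψ (e.symm (a, b)) * star (v b) with hW
    have eV : ∑ b, ‖v b‖ ^ 2 = ‖V‖ ^ 2 := by rw [EuclideanSpace.norm_sq_eq]
    have eW : ∑ a, ‖∑ b, ψ (e.symm (a, b)) * star (v b)‖ ^ 2 = ‖W‖ ^ 2 := by
      rw [EuclideanSpace.norm_sq_eq]
    rw [eV, eW]
    by_cases hW0 : W = 0
    · rw [hW0]; simp; positivity
    have hV0 : V ≠ 0 := by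
      intro h0
      apply hW0
      have hv : ∀ b, v b = 0 := fun b => congrArg (fun z : EuclideanSpace ℂ B => z b) h0
      ext a
      simp [hW, hv]
    have nV : 0 < ‖V‖ := norm_pos_iff.2 hV0
    have nW : 0 < ‖W‖ := norm_pos_iff.2 hW0
    have h1 := h (((‖W‖⁻¹ : ℝ) : ℂ) • W) (((‖V‖⁻¹ : ℝ) : ℂ) • V)
      (by rw [norm_smul, Complex.norm_real, norm_inv, norm_norm, inv_mul_cancel₀ nW.ne'])
      (by rw [norm_smul, Complex.norm_real, norm_inv, norm_norm, inv_mul_cancel₀ nV.ne'])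
    have h2 : star (tensorVec e (((‖W‖⁻¹ : ℝ) : ℂ) • W) (((‖V‖⁻¹ : ℝ) : ℂ) • V)).ofLp ⬝ᵥ ψ.ofLp =
        ((‖W‖⁻¹ * ‖V‖⁻¹ : ℝ) : ℂ) * (star W.ofLp ⬝ᵥ W.ofLp) := by
      simp only [dotProduct, sum_equiv_prod e, Finset.mul_sum]
      refine Finset.sum_congr rfl fun a _ => ?_
      have : W.ofLp a = ∑ b, ψ (e.symm (a, b)) * star (v b) := rfl
      conv_rhs => rw [this, Finset.mul_sum, Finset.mul_sum]
      refine Finset.sum_congr rfl fun b _ => ?_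
      simp [tensorVec, hV]
      ring
    have h3 : star W.ofLp ⬝ᵥ W.ofLp = ((‖W‖ ^ 2 : ℝ) : ℂ) := by
      rw [dotProduct_comm, ← EuclideanSpace.inner_eq_star_dotProduct, inner_self_eq_norm_sq_to_K]
      norm_cast
    rw [h2, h3, ← Complex.ofReal_mul, Complex.norm_real, Real.norm_eq_abs, sq_abs] at h1
    have h4 : (‖W‖⁻¹ * ‖V‖⁻¹ * ‖W‖ ^ 2) ^ 2 = ‖W‖ ^ 2 / ‖V‖ ^ 2 := by field_simp
    rwa [h4, div_le_iff₀ (by positivity)] at h1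
  rw [purity, Finset.sum_comm]
  calc _ ≤ ∑ a', l * ∑ b, ‖ψ (e.symm (a', b))‖ ^ 2 :=
        Finset.sum_le_sum fun a' _ => key fun b => ψ (e.symm (a', b))
    _ = l * ‖ψ‖ ^ 2 := by
        rw [← Finset.mul_sum, EuclideanSpace.norm_sq_eq, sum_equiv_prod e]
    _ = l := by rw [hψ]; ring

end Bipartite

/-! ### The swap test and its independent repetition. -/

section SwapTest

variable {X A B : Type} (e : X ≃ A × B)

/-- Exchange of the `A`-parts of two copies of `X ≃ A × B`. -/
def swapLeft (p : X × X) : X × X :=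
  (e.symm ((e p.2).1, (e p.1).2), e.symm ((e p.1).1, (e p.2).2))

lemma swapLeft_involutive : Function.Involutive (swapLeft e) := fun p => by
  simp [swapLeft]

variable [DecidableEq X]

/-- The permutation matrix exchanging the `A`-parts of two copies. -/
def swapMatrix : Matrix (X × X) (X × X) ℂ :=
  Matrix.of fun p q => if swapLeft e p = q then 1 else 0

/-- The accepting projection of the swap test on the `A`-parts of two copies. -/
def swapTest : Matrix (X × X) (X × X) ℂ := (1 / 2 : ℂ) • (1 + swapMatrix e)

lemma swapMatrix_isHermitian : (swapMatrix e).IsHermitian := by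
  ext p q
  have : swapLeft e q = p ↔ swapLeft e p = q :=
    ⟨fun h => by rw [← h, swapLeft_involutive], fun h => by rw [← h, swapLeft_involutive]⟩
  simp only [conjTranspose_apply, swapMatrix, of_apply, this]
  split_ifs <;> simp

lemma swapTest_isHermitian : (swapTest e).IsHermitian := by
  rw [IsHermitian, swapTest, conjTranspose_smul, conjTranspose_add,
    (swapMatrix_isHermitian e).eq, conjTranspose_one]
  simp

/-- `m` independent swap tests on `m + m` copies. -/
def repeatedSwapTest (m : ℕ) : Matrix (Fin (m + m) → X) (Fin (m + m) → X) ℂ :=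
  (matrixTensorPow m (swapTest e)).submatrix (pairsEquiv X m) (pairsEquiv X m)

lemma repeatedSwapTest_isHermitian (m : ℕ) : (repeatedSwapTest e m).IsHermitian :=
  (matrixTensorPow_isHermitian m (swapTest_isHermitian e)).submatrix _

variable [Fintype X]

lemma swapMatrix_mulVec (u : X × X → ℂ) : swapMatrix e *ᵥ u = u ∘ swapLeft e := by
  ext p
  simp [swapMatrix, mulVec, dotProduct]

lemma swapMatrix_mul_self : swapMatrix e * swapMatrix e = 1 := by
  ext p q
  rw [mul_apply, Finset.sum_eq_single (swapLeft e p) (fun r _ hr => by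
    simp [swapMatrix, hr.symm]) (by simp)]
  simp [swapMatrix, swapLeft_involutive e p, one_apply]

lemma swapTest_mul_self : swapTest e * swapTest e = swapTest e := by
  rw [swapTest, smul_mul_smul_comm, add_mul, mul_add, mul_add, swapMatrix_mul_self, one_mul,
    one_mul, mul_one]
  module

/-- Exchanging the `A`-parts of two copies of `α ⊗ β` changes nothing; this gives perfect
completeness, which the quantum OR requires. -/
lemma swapTest_mulVec_of_product {ψ : X → ℂ} {α : A → ℂ} {β : B → ℂ}
    (h : ∀ x, ψ x = α (e x).1 * β (e x).2) :
    swapTest e *ᵥ pairVec ψ = pairVec ψ := by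
  rw [swapTest, smul_mulVec, add_mulVec, one_mulVec, swapMatrix_mulVec]
  ext p
  simp only [Pi.smul_apply, Pi.add_apply, Function.comp_apply, pairVec, swapLeft, h, smul_eq_mul,
    Equiv.apply_symm_apply]
  ring

lemma repeatedSwapTest_mul_self (m : ℕ) :
    repeatedSwapTest e m * repeatedSwapTest e m = repeatedSwapTest e m := by
  rw [repeatedSwapTest, submatrix_mul_equiv, matrixTensorPow_mul, swapTest_mul_self]

lemma repeatedSwapTest_mulVec (m : ℕ) (ψ : EuclideanSpace ℂ X) :
    repeatedSwapTest e m *ᵥ (tensorPow (m + m) ψ).ofLp =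
      (fun y => ∏ j, (swapTest e *ᵥ pairVec ψ.ofLp) (y j)) ∘
        pairsEquiv X m := by
  rw [repeatedSwapTest, tensorPow_eq_pairs, submatrix_mulVec_equiv, Function.comp_assoc,
    Equiv.self_comp_symm, Function.comp_id, matrixTensorPow_mulVec]

lemma repeatedSwapTest_mulVec_of_product (m : ℕ) {ψ : EuclideanSpace ℂ X} {α : A → ℂ} {β : B → ℂ}
    (h : ∀ x, ψ x = α (e x).1 * β (e x).2) :
    repeatedSwapTest e m *ᵥ (tensorPow (m + m) ψ).ofLp = (tensorPow (m + m) ψ).ofLp := by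
  rw [repeatedSwapTest_mulVec, swapTest_mulVec_of_product e h, tensorPow_eq_pairs]

variable [Fintype A] [Fintype B]

lemma star_dotProduct_swapMatrix (ψ : X → ℂ) :
    star (pairVec ψ) ⬝ᵥ swapMatrix e *ᵥ pairVec ψ = (purity e ψ : ℂ) := by
  rw [swapMatrix_mulVec, purity, dotProduct, Fintype.sum_prod_type, sum_equiv_prod e]
  simp_rw [fun x => sum_equiv_prod e
    (fun y => star (pairVec ψ) (x, y) * (pairVec ψ ∘ swapLeft e) (x, y))]
  push_cast
  refine Finset.sum_congr rfl fun a _ => ?_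
  rw [Finset.sum_comm]
  refine Finset.sum_congr rfl fun a' _ => ?_
  rw [← Complex.conj_mul', map_sum, Finset.sum_mul_sum]
  refine Finset.sum_congr rfl fun b _ => Finset.sum_congr rfl fun b' _ => ?_
  simp [swapLeft, pairVec]
  ring

lemma star_dotProduct_swapTest {ψ : EuclideanSpace ℂ X} (hψ : ‖ψ‖ = 1) :
    star (pairVec ψ.ofLp) ⬝ᵥ swapTest e *ᵥ pairVec ψ.ofLp =
      (((1 + purity e ψ.ofLp) / 2 : ℝ) : ℂ) := by
  have h : star (pairVec ψ.ofLp) ⬝ᵥ pairVec ψ.ofLp = 1 := by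
    have h1 := dotProduct_star_self_of_norm_eq_one hψ
    rw [dotProduct, Fintype.sum_prod_type]
    rw [dotProduct] at h1
    calc _ = (∑ x, star ψ.ofLp x * ψ.ofLp x) * ∑ x, star ψ.ofLp x * ψ.ofLp x := by
          rw [Finset.sum_mul_sum]
          refine Finset.sum_congr rfl fun b _ => Finset.sum_congr rfl fun b' _ => ?_
          simp [pairVec]
          ring
      _ = 1 := by rw [h1, one_mul]
  rw [swapTest, smul_mulVec, add_mulVec, one_mulVec, dotProduct_smul, dotProduct_add,
    star_dotProduct_swapMatrix, h, smul_eq_mul]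
  push_cast
  ring

lemma acceptProb_repeatedSwapTest (m : ℕ) {ψ : EuclideanSpace ℂ X} (hψ : ‖ψ‖ = 1) :
    acceptProb (repeatedSwapTest e m) (tensorPow (m + m) ψ) =
      ((1 + purity e ψ.ofLp) / 2) ^ m := by
  rw [acceptProb_eq, repeatedSwapTest_mulVec, tensorPow_eq_pairs]
  have : ∀ f g : (Fin m → X × X) → ℂ,
      star (f ∘ pairsEquiv X m) ⬝ᵥ (g ∘ pairsEquiv X m) = star f ⬝ᵥ g := fun f g =>
    (pairsEquiv X m).sum_comp fun y => star (f y) * g y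
  rw [this, star_prod_dotProduct_prod, star_dotProduct_swapTest e hψ, ← Complex.ofReal_pow,
    Complex.ofReal_re]

end SwapTest

/-! ### Cuts of the parties and the tester. -/

section Cuts

variable {n : ℕ} {d : Fin n → ℕ}

/-- Splitting the parties along the cut `S : Sᶜ`. -/
def cutEquiv (d : Fin n → ℕ) (S : Finset (Fin n)) :
    ((i : Fin n) → Fin (d i)) ≃
      ((i : {i // i ∈ S}) → Fin (d i)) × ((i : {i // i ∉ S}) → Fin (d i)) :=
  Equiv.piEquivPiSubtypeProd (· ∈ S) fun i => Fin (d i)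

lemma tensorVec_mem_productAcrossSomeCut {S : Finset (Fin n)} (hS : S.Nonempty)
    (hS' : S ≠ Finset.univ) {α : EuclideanSpace ℂ ((i : {i // i ∈ S}) → Fin (d i))}
    {β : EuclideanSpace ℂ ((i : {i // i ∉ S}) → Fin (d i))} (hα : ‖α‖ = 1) (hβ : ‖β‖ = 1) :
    tensorVec (cutEquiv d S) α β ∈ productAcrossSomeCut d :=
  ⟨norm_tensorVec _ hα hβ, S, hS, hS', α, β, hα, hβ, fun _ => rfl⟩

lemma overlap_le_of_far {ψ : Qudits d} (hψ : ‖ψ‖ = 1) {ε : ℝ} (hε : 0 < ε)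
    (hfar : (ε : EReal) ≤ ⨅ φ ∈ productAcrossSomeCut d, (traceDist ψ φ : EReal))
    {φ : Qudits d} (hφ : φ ∈ productAcrossSomeCut d) :
    ‖star φ.ofLp ⬝ᵥ ψ.ofLp‖ ^ 2 ≤ 1 - ε ^ 2 := by
  have h : ε ≤ traceDist ψ φ := EReal.coe_le_coe_iff.1 (hfar.trans (iInf₂_le φ hφ))
  have h2 := traceDist_sq hψ hφ.1
  have h3 : ε ^ 2 ≤ traceDist ψ φ ^ 2 := pow_le_pow_left₀ hε.le h 2
  linarith

/-- A unit vector rules out a zero local dimension, and any basis vector is a product. -/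
lemma productAcrossSomeCut_nonempty (hn : 2 ≤ n) {ψ : Qudits d} (hψ : ‖ψ‖ = 1) :
    (productAcrossSomeCut d).Nonempty := by
  have hne : Nonempty ((i : Fin n) → Fin (d i)) := by
    by_contra h
    rw [not_nonempty_iff] at h
    have : ψ = 0 := Subsingleton.elim _ _
    simp [this] at hψ
  obtain ⟨x⟩ := hne
  have hS : ({⟨0, by omega⟩} : Finset (Fin n)) ≠ Finset.univ := by
    intro h
    have h1 := congrArg Finset.card h
    rw [Finset.card_singleton, Finset.card_univ, Fintype.card_fin] at h1
    omega
  exact ⟨_, tensorVec_mem_productAcrossSomeCut (Finset.singleton_nonempty _) hS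
    (α := EuclideanSpace.single (fun i => x i) 1) (β := EuclideanSpace.single (fun i => x i) 1)
    (by simp) (by simp)⟩

lemma productAcrossSomeCut_eq_empty (hn : n < 2) : productAcrossSomeCut d = ∅ := by
  rw [Set.eq_empty_iff_forall_notMem]
  rintro ψ ⟨-, S, ⟨i, hi⟩, hS, -⟩
  apply hS
  ext j
  have : j = i := Fin.ext (by omega)
  simp [this, hi]

lemma isMeasurement_zero {ι : Type} [Fintype ι] [DecidableEq ι] :
    IsMeasurement (0 : Matrix ι ι ℂ) :=
  ⟨PosSemidef.zero, by rw [sub_zero]; exact PosSemidef.one⟩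

lemma isMeasurement_one {ι : Type} [Fintype ι] [DecidableEq ι] :
    IsMeasurement (1 : Matrix ι ι ℂ) :=
  ⟨PosSemidef.one, by rw [sub_self]; exact PosSemidef.zero⟩

/-- The quantum OR of the repeated swap tests across all cuts is a tester. -/
theorem exists_tester {ε : ℝ} (hε : 0 < ε) (hε1 : ε ≤ 1) (m : ℕ)
    (hm : 2 * (2 ^ n * (1 - ε ^ 2 / 2) ^ m) ≤ 1 / 3) (d : Fin n → ℕ) :
    ∃ Λ, IsTester (productAcrossSomeCut d) ε (m + m) Λ := by
  set I : Finset (Finset (Fin n)) :=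
    Finset.univ.filter fun S => S.Nonempty ∧ S ≠ Finset.univ with hI
  obtain ⟨Λ, hΛ, h⟩ := exists_or_measurement I (fun S => repeatedSwapTest (cutEquiv d S) m)
    (fun S => repeatedSwapTest_isHermitian _ m) (fun S => repeatedSwapTest_mul_self _ m)
  refine ⟨Λ, hΛ, fun ψ hψ => ⟨?_, fun hfar => ?_⟩⟩
  · rintro ⟨-, S, hS, hS', α, β, -, -, hαβ⟩
    exact (h _ (norm_tensorPow _ hψ)).1 ⟨S, by simp [hI, hS, hS'],
      repeatedSwapTest_mulVec_of_product (cutEquiv d S) m hαβ⟩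
  · have hl : 0 ≤ 1 - ε ^ 2 := by nlinarith
    have hS : ∀ S ∈ I, acceptProb (repeatedSwapTest (cutEquiv d S) m) (tensorPow (m + m) ψ) ≤
        (1 - ε ^ 2 / 2) ^ m := by
      intro S hS
      rw [hI, Finset.mem_filter] at hS
      rw [acceptProb_repeatedSwapTest _ _ hψ]
      have h0 := purity_nonneg (cutEquiv d S) ψ.ofLp
      have h1 := purity_le (cutEquiv d S) hψ hl fun α β hα hβ =>
        overlap_le_of_far hψ hε hfar
          (tensorVec_mem_productAcrossSomeCut hS.2.1 hS.2.2 hα hβ)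
      exact pow_le_pow_left₀ (by linarith) (by linarith) m
    have hcard : (I.card : ℝ) ≤ 2 ^ n := by
      have := Finset.card_filter_le (Finset.univ : Finset (Finset (Fin n)))
        fun S => S.Nonempty ∧ S ≠ Finset.univ
      rw [Finset.card_univ, Fintype.card_finset, Fintype.card_fin] at this
      exact_mod_cast this
    have h1 := (h _ (norm_tensorPow (m + m) hψ)).2
    have h2 := Finset.sum_le_card_nsmul I _ _ hS
    rw [nsmul_eq_mul] at h2
    have h3 : (I.card : ℝ) * (1 - ε ^ 2 / 2) ^ m ≤ 2 ^ n * (1 - ε ^ 2 / 2) ^ m :=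
      mul_le_mul_of_nonneg_right hcard (pow_nonneg (by nlinarith) m)
    linarith

end Cuts

/-- The failure probability of `4 n / ε²` swap tests, summed over the cuts. -/
lemma two_pow_mul_failure_le {n m : ℕ} (hn : 2 ≤ n) {ε : ℝ} (hε : 0 < ε) (hε1 : ε ≤ 1)
    (hm : 4 * (n / ε ^ 2) ≤ (m : ℝ)) :
    2 * ((2 : ℝ) ^ n * (1 - ε ^ 2 / 2) ^ m) ≤ 1 / 3 := by
  have h1 : (1 - ε ^ 2 / 2) ^ m ≤ Real.exp (-2) ^ n := by
    calc (1 - ε ^ 2 / 2) ^ m ≤ Real.exp (-(ε ^ 2 / 2)) ^ m :=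
          pow_le_pow_left₀ (by nlinarith) (by linarith [Real.add_one_le_exp (-(ε ^ 2 / 2))]) m
      _ = Real.exp (m * -(ε ^ 2 / 2)) := (Real.exp_nat_mul _ m).symm
      _ ≤ Real.exp (n * -2) := by
          apply Real.exp_le_exp.2
          have h : 4 * (n / ε ^ 2) * (ε ^ 2 / 2) = n * 2 := by field_simp; ring
          have := mul_le_mul_of_nonneg_right hm (by positivity : 0 ≤ ε ^ 2 / 2)
          linarith
      _ = Real.exp (-2) ^ n := Real.exp_nat_mul _ n
  have h2 : 2 * Real.exp (-2) ≤ 1 / 3 := by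
    have h : Real.exp 2 = Real.exp 1 * Real.exp 1 := by rw [← Real.exp_add]; norm_num
    have h3 : 6 ≤ Real.exp 2 := by rw [h]; nlinarith [Real.exp_one_gt_d9]
    rw [Real.exp_neg, ← div_eq_mul_inv, div_le_iff₀ (Real.exp_pos 2)]
    linarith
  calc 2 * ((2 : ℝ) ^ n * (1 - ε ^ 2 / 2) ^ m) ≤ 2 * (2 ^ n * Real.exp (-2) ^ n) := by gcongr
    _ = 2 * (2 * Real.exp (-2)) ^ n := by rw [mul_pow]
    _ ≤ 2 * (1 / 3) ^ n := by gcongr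
    _ ≤ 2 * (1 / 3) ^ 2 := by
        -- `n ≥ 2` matters: 2/9 is below 1/3, while exponent 1 would leave 2/3.
        gcongr 2 * ?_
        exact pow_le_pow_of_le_one (by norm_num) (by norm_num) hn
    _ ≤ 1 / 3 := by norm_num

end QTest

end

theorem mainTheorem5 :
    ∃ C : ℝ, 0 < C ∧ ∀ (n : ℕ) (ε : ℝ), 0 < ε →
      ∃ k : ℕ, (k : ℝ) ≤ C * (n / ε ^ 2) ∧
        ∀ d : Fin n → ℕ,
          ∃ Λ : Matrix (Fin k → ((i : Fin n) → Fin (d i))) (Fin k → ((i : Fin n) → Fin (d i))) ℂ,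
            QTest.IsTester (QTest.productAcrossSomeCut d) ε k Λ := by
  -- Two copies per swap test give 8n/ε²; rounding up adds at most 2, which is at most 2n/ε² in the
  -- main case.
  refine ⟨10, by norm_num, fun n ε hε => ?_⟩
  rcases lt_or_ge n 2 with hn | hn
  -- No cut exists, so always rejecting is correct.
  · refine ⟨0, by simp; positivity, fun d => ⟨0, QTest.isMeasurement_zero, fun ψ _ => ⟨?_, ?_⟩⟩⟩
    · rw [QTest.productAcrossSomeCut_eq_empty hn]
      exact fun h => h.elim
    · intro _
      norm_num [QTest.acceptProb]
  rcases lt_or_ge 1 ε with hε1 | hε1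
  -- No state is at distance more than 1 from the nonempty property, so always accepting is correct.
  · refine ⟨0, by simp; positivity, fun d => ⟨1, QTest.isMeasurement_one, fun ψ hψ => ⟨?_, ?_⟩⟩⟩
    · intro _
      rw [QTest.acceptProb_eq, Matrix.one_mulVec,
        QTest.dotProduct_star_self_of_norm_eq_one (QTest.norm_tensorPow 0 hψ)]
      norm_num
    · intro hfar
      obtain ⟨φ, hφ⟩ := QTest.productAcrossSomeCut_nonempty hn hψ
      have h := QTest.overlap_le_of_far hψ hε hfar hφ
      nlinarith [sq_nonneg ‖star φ.ofLp ⬝ᵥ ψ.ofLp‖]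
  · have h1 : (1 : ℝ) ≤ n / ε ^ 2 := by
      rw [le_div_iff₀ (by positivity)]
      have : (2 : ℝ) ≤ n := by exact_mod_cast hn
      nlinarith
    refine ⟨⌈4 * (n / ε ^ 2)⌉₊ + ⌈4 * (n / ε ^ 2)⌉₊, ?_,
      QTest.exists_tester hε hε1 _ (QTest.two_pow_mul_failure_le hn hε hε1 (Nat.le_ceil _))⟩
    have := Nat.ceil_lt_add_one (a := 4 * ((n : ℝ) / ε ^ 2)) (by positivity)
    push_cast
    linarith
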